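/- Let $\kappa\neq 0$ and let $M_\kappa^2$ be the complete simply connected surface of constant curvature $\kappa$ (a rescaled hyperbolic plane if $\kappa<0$, a round sphere of radius $\kappa^{-1/2}$ if $\kappa>0$). A triangle is a triple of points $(A,B,C)$ of $M_\kappa^2$ with the minimal geodesics joining them; if $\kappa>0$ the three points are required to lie in a common open hemisphere. It is non-degenerate if no vertex lies on the geodesic segment joining the other two. Its side lengths are $a=|BC|$, $b=|CA|$, $c=|AB|$. Let $D,E,F$ be the midpoints of the sides $BC,CA,AB$. The medial subdivision of $(A,B,C)$ consists of the four labelled triangles $(D,E,F)$ (the innermost one) and $(A,F,E)$, $(F,B,D)$, $(E,D,C)$ (the outer ones at $A$, $B$ and $C$). A sequence of triangles $t_0,t_1,\dots$ is nested if each $t_{n+1}$ is one of the four triangles of the medial subdivision of $t_n$; write $a_n,b_n,c_n$ for the side lengths of $t_n$. The side $a_{n+1}$ is the parallel side of $a_n$ if $t_{n+1}$ is the innermost triangle or the outer triangle at the vertex opposite to $a_n$, i.e. if $a_{n+1}$ joins the midpoints of the two other sides of $t_n$; otherwise $a_{n+1}$ is one half of $a_n$. **Theorem C.** (Hyperbolic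 geometry) Let $\kappa<0$. To each triangle $t_0$ one can associate a constant $l_a=l_a(t_0)>0$ such that for every nested sequence $t_0,t_1,\dots$ starting at $t_0$ and all $n\in\mathbb N$ $$a_0\cdot l_a\le 2^n\cdot a_n\le a_0 .$$ If $t_0$ is non-degenerate and $a_{m+1}$ is the parallel side of $a_m$ for some $m$, then moreover $a_0\cdot l_a<2^n\cdot a_n$ for all $n$ and $2^n\cdot a_n<a_0$ for all $n>m$. For non-degenerate $t_0$ one has $l_a(t_0)<1$, and $l_a(t_0)\to1$ as all the side lengths of $t_0$ tend to $0$. (Spherical geometry) Let $\kappa>0$. To each triangle $t_0$ one can associate a constant $L_a=L_a(t_0)>0$ such that for every nested sequence $t_0,t_1,\dots$ starting at $t_0$ and all $n\in\mathbb N$ $$a_0\le 2^n\cdot a_n\le a_0\cdot L_a .$$ If $t_0$ is non-degenerate and $a_{m+1}$ is the parallel side of $a_m$ for some $m$, then moreover $2^n\cdot a_n<a_0\cdot L_a$ for all $n$ and $a_0<2^n\cdot a_n$ for all $n>m$. For non-degenerate $t_0$ one has $L_a(t_0)>1$, and $L_a(t_0)\to1$ as all the side lengths of $t_0$ tend to $0$.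 The same statements hold for $b_n$ and $c_n$, with constants $l_b,l_c$ and $L_b,L_c$. -/

import Mathlib

namespace MedialSubdivision

/-- Distance of the complete simply connected surface of constant curvature `κ < 0`: the
hyperbolic distance of the upper half-plane (curvature `-1`), rescaled by `|κ|^(-1/2)`. -/
noncomputable def hypDist (κ : ℝ) (z w : UpperHalfPlane) : ℝ :=
  dist z w / Real.sqrt (-κ)

/-- The unit sphere of Euclidean 3-space. -/
abbrev Sphere2 : Type := Metric.sphere (0 : EuclideanSpace ℝ (Fin 3)) 1

/-- Distance of the sphere of constant curvature `κ > 0`: the great-circle (angular) distance of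
the unit sphere, rescaled by `κ^(-1/2)`. -/
noncomputable def sphDist (κ : ℝ) (x y : Sphere2) : ℝ :=
  InnerProductGeometry.angle (x : EuclideanSpace ℝ (Fin 3)) (y : EuclideanSpace ℝ (Fin 3)) /
    Real.sqrt κ

/-- The three vertices lie in a common open hemisphere. -/
def InOpenHemisphere (t : Fin 3 → Sphere2) : Prop :=
  ∃ u : EuclideanSpace ℝ (Fin 3), ∀ i, 0 < inner ℝ u (t i : EuclideanSpace ℝ (Fin 3))

/-- `m` is the midpoint of the minimal geodesic from `x` to `y`, for the distance `d`. -/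
def IsMidpoint {X : Type*} (d : X → X → ℝ) (x y m : X) : Prop :=
  d x m = d x y / 2 ∧ d m y = d x y / 2

/-- Length of the `i`-th side of a labelled triangle, the side opposite to the vertex `t i`. -/
def side {X : Type*} (d : X → X → ℝ) (t : Fin 3 → X) (i : Fin 3) : ℝ :=
  d (t (i + 1)) (t (i + 2))

/-- The triangle is non-degenerate: all triangle inequalities between its sides are strict, that
is, no vertex lies on the geodesic segment joining the other two. -/
def Nondegenerate {X : Type*} (d : X → X → ℝ) (t : Fin 3 → X) : Prop :=
  ∀ i, side d t i < side d t (i + 1) + side d t (i + 2)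

/-- The four triangles of the medial subdivision of a triangle: the innermost one, and the outer
one at each of the three vertices. -/
inductive Piece : Type
  | inner : Piece
  | corner (k : Fin 3) : Piece

/-- `t'` is the piece `p` of the medial subdivision of `t`. The labels are such that the `i`-th
side of `t'` is the half of the `i`-th side of `t` contained in `t'` if there is one, and is
otherwise the segment joining the midpoints of the other two sides of `t`. -/
def IsPieceOf {X : Type*} (d : X → X → ℝ) (p : Piece) (t t' : Fin 3 → X) : Prop :=
  match p with
  | Piece.inner => ∀ i, IsMidpoint d (t (i + 1)) (t (i + 2)) (t' i)
  | Piece.corner k => t' k = t k ∧ ∀ j, j ≠ k → IsMidpoint d (t k) (t j) (t' j)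

/-- Passing to the piece `p` replaces the `i`-th side by its parallel side, the segment joining
the midpoints of the other two sides (rather than by one of its halves). -/
def IsParallelStep (p : Piece) (i : Fin 3) : Prop :=
  p = Piece.inner ∨ p = Piece.corner i

/-- `t 0, t 1, …` is a sequence of nested triangles: `t (n + 1)` is the piece `p n` of the medial
subdivision of `t n`. -/
def IsNested {X : Type*} (d : X → X → ℝ) (p : ℕ → Piece) (t : ℕ → Fin 3 → X) : Prop :=
  ∀ n, IsPieceOf d (p n) (t n) (t (n + 1))

end MedialSubdivision

/-!
In both geometries a median from `z` to the midpoint `m` of `x` and `y` obeys the law of cosines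
`C (d z x) + C (d z y) = 2 * C (d x y / 2) * C (d z m)`, with `C = cosh` or `C = cos`. It expresses
the parallel side through the half sides, and the difference of the values of `C` at half the side
and at the parallel side is, up to a positive factor, the Gram determinant of the half sides. Its
sign, which the triangle inequality determines, compares the parallel side with half the side; it
vanishes only for degenerate triangles, and the pieces of a non-degenerate triangle are
non-degenerate.

In the other direction, a subdivision changes twice the side by at most a factor `exp (c * r ^ 2)`,
where `r` bounds the size of the triangle. As `r` decays geometrically along a nested sequence,
these factors have a convergent product. In the hyperbolic case the decay is clear, because each
side shrinks at least by half. In the spherical case sides may grow, but the central projection of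
a cap to a tangent plane maps geodesics to straight segments and midpoints to points that divide
them in a bounded ratio, so that the diameter of the projected triangle shrinks by a fixed factor.
-/

namespace MedialSubdivision

/-! ### Gram determinants of three unit vectors -/

/-- The determinant of the symmetric `3 × 3` matrix with diagonal entries `1` and off-diagonal
entries `x`, `y`, `z`. -/
def gram (x y z : ℝ) : ℝ :=
  1 + 2 * x * y * z - x ^ 2 - y ^ 2 - z ^ 2

theorem gram_rotate (x y z : ℝ) : gram y z x = gram x y z := by
  simp only [gram]
  ring

theorem gram_double (x y z : ℝ) :
    gram (2 * x ^ 2 - 1) (2 * y ^ 2 - 1) (2 * z ^ 2 - 1) =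
      4 * gram x y z * (2 * x * y * z + x ^ 2 + y ^ 2 + z ^ 2 - 1) := by
  simp only [gram]
  ring

theorem gram_double_of_midline {x y z w : ℝ}
    (hw : 2 * y * z * w = x ^ 2 + y ^ 2 + z ^ 2 - 1) :
    gram (2 * x ^ 2 - 1) (2 * y ^ 2 - 1) (2 * z ^ 2 - 1) =
      16 * y ^ 2 * z ^ 2 * gram w y z := by
  have hgram : gram x y z = 2 * y * z * (x - w) := by
    rw [gram]
    linear_combination hw
  have hgram' : gram w y z = x ^ 2 - w ^ 2 := by
    rw [gram]
    linear_combination hw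
  rw [gram_double, hgram, hgram']
  linear_combination -8 * y * z * (x - w) * hw

theorem gram_double_of_midlines {x y z u v w : ℝ}
    (hu : 2 * y * z * u = x ^ 2 + y ^ 2 + z ^ 2 - 1)
    (hv : 2 * z * x * v = y ^ 2 + z ^ 2 + x ^ 2 - 1)
    (hw : 2 * x * y * w = z ^ 2 + x ^ 2 + y ^ 2 - 1) :
    gram (2 * x ^ 2 - 1) (2 * y ^ 2 - 1) (2 * z ^ 2 - 1) =
      16 * x ^ 2 * y ^ 2 * z ^ 2 * gram u v w := by
  have huvw : (2 * y * z * u) * (2 * z * x * v) * (2 * x * y * w) =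
      (x ^ 2 + y ^ 2 + z ^ 2 - 1) ^ 3 := by
    rw [hu, hv, hw]
    ring
  have hu2 := congrArg (· ^ 2) hu
  have hv2 := congrArg (· ^ 2) hv
  have hw2 := congrArg (· ^ 2) hw
  simp only [gram]
  linear_combination -4 * huvw + 4 * x ^ 2 * hu2 + 4 * y ^ 2 * hv2 + 4 * z ^ 2 * hw2

theorem fin_three_add_add (i : Fin 3) :
    i + 1 + 1 = i + 2 ∧ i + 1 + 2 = i ∧ i + 2 + 1 = i ∧ i + 2 + 2 = i + 1 := by
  decide +revert

/-! ### Geometries with a median formula -/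

/-- A symmetric distance with the triangle inequality whose medians obey the law of cosines for
the function `C`: this is `cosh` in curvature `-1` and `cos` in curvature `1`. -/
structure IsMedianGeometry {X : Type*} (d : X → X → ℝ) (C : ℝ → ℝ) : Prop where
  symm : ∀ x y, d x y = d y x
  triangle : ∀ x y z, d x z ≤ d x y + d y z
  double : ∀ s, C s = 2 * C (s / 2) ^ 2 - 1
  median : ∀ {x y m}, IsMidpoint d x y m → ∀ z,
    C (d z x) + C (d z y) = 2 * C (d x y / 2) * C (d z m)

/-- The sum of the three sides of a triangle. -/
def perimeter {X : Type*} (d : X → X → ℝ) (t : Fin 3 → X) : ℝ :=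
  ∑ i, side d t i

/-- The Gram determinant of the vertices of a triangle, computed from its sides. -/
def gramDet {X : Type*} (d : X → X → ℝ) (C : ℝ → ℝ) (t : Fin 3 → X) : ℝ :=
  gram (C (side d t 0)) (C (side d t 1)) (C (side d t 2))

section MedianGeometry

variable {X : Type*} {d : X → X → ℝ} {C : ℝ → ℝ} {p : Piece} {t t' : Fin 3 → X}

theorem Nondegenerate.side_pos (ht : Nondegenerate d t) (i : Fin 3) : 0 < side d t i := by
  obtain ⟨h11, h12, h21, h22⟩ := fin_three_add_add i
  have h1 := ht (i + 1)
  have h2 := ht (i + 2)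
  rw [h11, h12] at h1
  rw [h21, h22] at h2
  linarith

theorem Nondegenerate.perimeter_pos (ht : Nondegenerate d t) : 0 < perimeter d t :=
  Finset.sum_pos (fun j _ => ht.side_pos j) Finset.univ_nonempty

theorem perimeter_eq (d : X → X → ℝ) (t : Fin 3 → X) (i : Fin 3) :
    perimeter d t = side d t i + side d t (i + 1) + side d t (i + 2) := by
  rw [perimeter, Fin.sum_univ_three]
  fin_cases i
  · rfl
  · exact add_rotate _ _ _
  · exact (add_rotate _ _ _).symm

theorem gramDet_eq (d : X → X → ℝ) (C : ℝ → ℝ) (t : Fin 3 → X) (i : Fin 3) :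
    gramDet d C t = gram (C (side d t i)) (C (side d t (i + 1))) (C (side d t (i + 2))) := by
  rw [gramDet]
  fin_cases i
  · rfl
  · exact (gram_rotate _ _ _).symm
  · exact gram_rotate _ _ _

namespace IsMedianGeometry

theorem nonneg (hd : IsMedianGeometry d C) (x y : X) : 0 ≤ d x y := by
  have hyy := hd.triangle y y y
  have hyxy := hd.triangle y x y
  rw [hd.symm y x] at hyxy
  linarith

theorem side_nonneg (hd : IsMedianGeometry d C) (t : Fin 3 → X) (i : Fin 3) : 0 ≤ side d t i :=
  hd.nonneg _ _

theorem perimeter_nonneg (hd : IsMedianGeometry d C) (t : Fin 3 → X) : 0 ≤ perimeter d t :=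
  Finset.sum_nonneg fun i _ => hd.side_nonneg t i

theorem side_le_perimeter (hd : IsMedianGeometry d C) (t : Fin 3 → X) (i : Fin 3) :
    side d t i ≤ perimeter d t :=
  Finset.single_le_sum (fun j _ => hd.side_nonneg t j) (Finset.mem_univ i)

theorem side_le_add (hd : IsMedianGeometry d C) (t : Fin 3 → X) (i : Fin 3) :
    side d t i ≤ side d t (i + 1) + side d t (i + 2) := by
  obtain ⟨h11, h12, h21, h22⟩ := fin_three_add_add i
  simp only [side, h11, h12, h21, h22]
  rw [add_comm (d _ _), hd.symm (t i) (t (i + 1)), hd.symm (t (i + 2)) (t i)]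
  exact hd.triangle _ _ _

theorem isMidpoint_symm (hd : IsMedianGeometry d C) {x y m : X} (h : IsMidpoint d x y m) :
    IsMidpoint d y x m := by
  rw [IsMidpoint, hd.symm y m, hd.symm m x, hd.symm y x]
  exact h.symm

theorem midline (hd : IsMedianGeometry d C) {x y z f e : X}
    (hf : IsMidpoint d x y f) (he : IsMidpoint d x z e) :
    2 * C (d x y / 2) * C (d x z / 2) * C (d f e) =
      C (d x y / 2) ^ 2 + C (d x z / 2) ^ 2 + C (d y z / 2) ^ 2 - 1 := by
  have hxye := hd.median hf e
  have hxzy := hd.median he y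
  rw [hd.symm e x, he.1, hd.symm e y, hd.symm e f] at hxye
  rw [hd.symm y x, hd.double (d x y), hd.double (d y z)] at hxzy
  linear_combination -C (d x z / 2) * hxye - hxzy / 2

theorem side_midline (hd : IsMedianGeometry d C) (ht : IsPieceOf d p t t') {i : Fin 3}
    (hp : IsParallelStep p i) :
    2 * C (side d t (i + 1) / 2) * C (side d t (i + 2) / 2) * C (side d t' i) =
      C (side d t i / 2) ^ 2 + C (side d t (i + 1) / 2) ^ 2 + C (side d t (i + 2) / 2) ^ 2
        - 1 := by
  obtain ⟨h11, h12, h21, h22⟩ := fin_three_add_add i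
  simp only [side, h11, h12, h21, h22]
  rw [hd.symm (t (i + 2)) (t i)]
  rcases hp with rfl | rfl
  · have hmid₁ := ht (i + 1)
    have hmid₂ := ht (i + 2)
    rw [h11, h12] at hmid₁
    rw [h21, h22] at hmid₂
    have h := hd.midline (hd.isMidpoint_symm hmid₁) hmid₂
    rw [hd.symm (t (i + 2)) (t (i + 1))] at h
    linear_combination h
  · have h := hd.midline (ht.2 (i + 1) (by simp)) (ht.2 (i + 2) (by simp))
    linear_combination h

theorem gram_half_sides (hd : IsMedianGeometry d C) (ht : IsPieceOf d p t t') {i : Fin 3}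
    (hp : IsParallelStep p i) :
    gram (C (side d t i / 2)) (C (side d t (i + 1) / 2)) (C (side d t (i + 2) / 2)) =
      2 * C (side d t (i + 1) / 2) * C (side d t (i + 2) / 2) *
        (C (side d t i / 2) - C (side d t' i)) := by
  rw [gram]
  linear_combination hd.side_midline ht hp

theorem side_eq_half (hd : IsMedianGeometry d C) (ht : IsPieceOf d p t t') {i : Fin 3}
    (hp : ¬ IsParallelStep p i) : side d t' i = side d t i / 2 := by
  cases p with
  | inner => exact absurd (Or.inl rfl) hp
  | corner k =>
    have hik : i ≠ k := fun h => hp (Or.inr (by rw [h]))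
    have hk : k = i + 1 ∨ k = i + 2 := by
      clear ht hp
      decide +revert
    rcases hk with rfl | rfl
    · rw [side, ht.1]
      exact (ht.2 _ (by simp)).1
    · rw [side, ht.1, hd.symm, side, hd.symm (t (i + 1))]
      exact (ht.2 _ (by simp)).1

theorem side_ne_two_mul (hd : IsMedianGeometry d C) (ht : IsPieceOf d p t t') {i : Fin 3}
    (hp : IsParallelStep p i) (hgram : gramDet d C t ≠ 0) : side d t i ≠ 2 * side d t' i := by
  intro h
  have hhalf : side d t' i = side d t i / 2 := by rw [h, mul_div_cancel_left₀ _ two_ne_zero]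
  apply hgram
  rw [gramDet_eq d C t i, hd.double (side d t i), hd.double (side d t (i + 1)),
    hd.double (side d t (i + 2)), gram_double, hd.gram_half_sides ht hp, hhalf, sub_self,
    mul_zero, mul_zero, zero_mul]

theorem gramDet_ne_zero_of_isPieceOf (hd : IsMedianGeometry d C) (ht : IsPieceOf d p t t')
    (hgram : gramDet d C t ≠ 0) : gramDet d C t' ≠ 0 := by
  refine fun h => hgram ?_
  have hdouble (i : Fin 3) := hd.double (side d t i)
  cases p with
  | inner =>
    have hmid (i : Fin 3) := hd.side_midline ht (i := i) (Or.inl rfl)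
    rw [gramDet, hdouble, hdouble, hdouble]
    exact (gram_double_of_midlines (hmid 0) (hmid 1) (hmid 2)).trans (mul_eq_zero_of_right _ h)
  | corner k =>
    have hhalf {i : Fin 3} (hi : i ≠ k) : side d t' i = side d t i / 2 :=
      hd.side_eq_half ht (by simpa [IsParallelStep] using hi.symm)
    rw [gramDet_eq d C t k, hdouble, hdouble, hdouble,
      gram_double_of_midline (hd.side_midline ht (Or.inr rfl)), ← hhalf (by simp),
      ← hhalf (by simp), ← gramDet_eq d C t' k, h, mul_zero]

theorem gramDet_ne_zero_of_isNested (hd : IsMedianGeometry d C) {p : ℕ → Piece}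
    {t : ℕ → Fin 3 → X} (ht : IsNested d p t) (hgram : gramDet d C (t 0) ≠ 0) (n : ℕ) :
    gramDet d C (t n) ≠ 0 := by
  induction n with
  | zero => exact hgram
  | succ n ih => exact hd.gramDet_ne_zero_of_isPieceOf (ht n) ih

end IsMedianGeometry

theorem isMidpoint_div {s : ℝ} (hs : s ≠ 0) {x y m : X} :
    IsMidpoint (fun x y => d x y / s) x y m ↔ IsMidpoint d x y m := by
  simp only [IsMidpoint, div_right_comm _ s, div_left_inj' hs]

theorem isNested_div {s : ℝ} (hs : s ≠ 0) {p : ℕ → Piece} {t : ℕ → Fin 3 → X} :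
    IsNested (fun x y => d x y / s) p t ↔ IsNested d p t := by
  refine forall_congr' fun n => ?_
  cases p n <;> simp only [IsPieceOf, isMidpoint_div hs]

theorem nondegenerate_div {s : ℝ} (hs : 0 < s) :
    Nondegenerate (fun x y => d x y / s) t ↔ Nondegenerate d t := by
  simp only [Nondegenerate, side, ← add_div, div_lt_div_iff_of_pos_right hs]

end MedianGeometry

/-! ### Quadric models -/

/-- The points of `X` are embedded by `φ` in the unit quadric of the symmetric bilinear form `B`,
which gives `C ∘ d` on points and has no null vectors in the tangent spaces: the unit sphere for
`C = cos`, and one sheet of the hyperboloid for `C = cosh`. -/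
structure IsQuadricModel {X W : Type*} [AddCommGroup W] [Module ℝ W] (B : LinearMap.BilinForm ℝ W)
    (φ : X → W) (d : X → X → ℝ) (C : ℝ → ℝ) : Prop where
  form_symm : ∀ v w, B v w = B w v
  form_self : ∀ x, B (φ x) (φ x) = 1
  form_eq : ∀ x y, B (φ x) (φ y) = C (d x y)
  definite : ∀ x w, B (φ x) w = 0 → B w w = 0 → w = 0
  symm : ∀ x y, d x y = d y x
  triangle : ∀ x y z, d x z ≤ d x y + d y z
  double : ∀ s, C s = 2 * C (s / 2) ^ 2 - 1

namespace IsQuadricModel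

variable {X W : Type*} [AddCommGroup W] [Module ℝ W] {B : LinearMap.BilinForm ℝ W}
  {φ : X → W} {d : X → X → ℝ} {C : ℝ → ℝ}

theorem add_eq_smul_midpoint (hφ : IsQuadricModel B φ d C) {x y m : X}
    (hm : IsMidpoint d x y m) : φ x + φ y = (2 * C (d x y / 2)) • φ m := by
  have hmx : B (φ m) (φ x) = C (d x y / 2) := by rw [hφ.form_symm, hφ.form_eq, hm.1]
  have hmy : B (φ m) (φ y) = C (d x y / 2) := by rw [hφ.form_eq, hm.2]
  have hxy : B (φ x) (φ y) = 2 * C (d x y / 2) ^ 2 - 1 := by rw [hφ.form_eq, hφ.double]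
  rw [← sub_eq_zero]
  apply hφ.definite m
  · simp only [map_sub, map_add, map_smul, smul_eq_mul, hφ.form_self, hmx, hmy]
    ring
  · simp only [map_sub, map_add, map_smul, LinearMap.sub_apply, LinearMap.add_apply,
      LinearMap.smul_apply, smul_eq_mul, hφ.form_self, hmx, hmy, hφ.form_symm (φ x) (φ m),
      hφ.form_symm (φ y) (φ m), hφ.form_symm (φ y) (φ x), hxy]
    ring

theorem isMedianGeometry (hφ : IsQuadricModel B φ d C) : IsMedianGeometry d C where
  symm := hφ.symm
  triangle := hφ.triangle
  double := hφ.double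
  median hm z := by
    rw [← hφ.form_eq, ← hφ.form_eq, ← map_add, hφ.add_eq_smul_midpoint hm, map_smul, smul_eq_mul,
      hφ.form_eq]

end IsQuadricModel

/-! ### Accumulated errors -/

section Stretch

open Real Filter Topology

variable {c q r : ℝ}

/-- The value of the product of the errors `exp (c * (q ^ n * r) ^ 2)` over all `n`, for
`|q| < 1`. -/
noncomputable def stretch (c q r : ℝ) : ℝ :=
  exp (c * r ^ 2 / (1 - q ^ 2))

theorem stretch_pos (c q r : ℝ) : 0 < stretch c q r :=
  exp_pos _

theorem stretch_eq_mul (hq : q ^ 2 < 1) :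
    stretch c q r = exp (c * r ^ 2) * stretch c q (q * r) := by
  have : 1 - q ^ 2 ≠ 0 := (sub_pos.2 hq).ne'
  rw [stretch, stretch, ← exp_add]
  congr 1
  field_simp
  ring

theorem one_le_stretch (hc : 0 ≤ c) (hq : q ^ 2 < 1) : 1 ≤ stretch c q r :=
  one_le_exp (div_nonneg (by positivity) (sub_pos.2 hq).le)

theorem one_lt_stretch (hc : 0 < c) (hq : q ^ 2 < 1) (hr : r ≠ 0) : 1 < stretch c q r :=
  one_lt_exp_iff.2 (div_pos (by positivity) (sub_pos.2 hq))

theorem tendsto_stretch_zero (c q : ℝ) : Tendsto (stretch c q) (𝓝 0) (𝓝 1) := by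
  have h : Continuous (stretch c q) := by
    unfold stretch
    fun_prop
  simpa [stretch] using h.tendsto 0

variable {a : ℕ → ℝ}

theorem antitone_two_pow_mul (h : ∀ n, 2 * a (n + 1) ≤ a n) : Antitone fun n => 2 ^ n * a n :=
  antitone_nat_of_succ_le fun n => by
    rw [pow_succ, mul_assoc]
    gcongr
    exact h n

theorem monotone_two_pow_mul (h : ∀ n, a n ≤ 2 * a (n + 1)) : Monotone fun n => 2 ^ n * a n :=
  monotone_nat_of_le_succ fun n => by
    rw [pow_succ, mul_assoc]
    gcongr
    exact h n

theorem antitone_two_pow_mul_stretch (hq : q ^ 2 < 1)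
    (h : ∀ n, 2 * a (n + 1) ≤ a n * exp (c * (q ^ n * r) ^ 2)) :
    Antitone fun n => 2 ^ n * (a n * stretch c q (q ^ n * r)) :=
  antitone_two_pow_mul fun n => by
    rw [stretch_eq_mul hq (r := q ^ n * r), ← mul_assoc q, ← pow_succ', ← mul_assoc, ← mul_assoc]
    exact mul_le_mul_of_nonneg_right (h n) (stretch_pos _ _ _).le

theorem monotone_two_pow_mul_div_stretch (hq : q ^ 2 < 1)
    (h : ∀ n, a n ≤ 2 * a (n + 1) * exp (c * (q ^ n * r) ^ 2)) :
    Monotone fun n => 2 ^ n * (a n / stretch c q (q ^ n * r)) :=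
  monotone_two_pow_mul fun n => by
    rw [stretch_eq_mul hq (r := q ^ n * r), ← mul_assoc q, ← pow_succ', ← div_div, mul_div_assoc']
    exact div_le_div_of_nonneg_right ((div_le_iff₀ (exp_pos _)).2 (h n)) (stretch_pos _ _ _).le

theorem IsMedianGeometry.exists_stretch_perimeter_lt {X : Type*} {d : X → X → ℝ} {C : ℝ → ℝ}
    (hd : IsMedianGeometry d C) (c q k : ℝ) {ε : ℝ} (hε : 0 < ε) :
    ∃ δ > 0, ∀ t, (∀ i, side d t i < δ) → stretch c q (k * perimeter d t) < 1 + ε := by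
  have hlim : Tendsto (fun x => stretch c q (k * x)) (𝓝 0) (𝓝 1) :=
    (tendsto_stretch_zero c q).comp (by simpa using (continuous_const_mul k).tendsto 0)
  obtain ⟨δ, hδ, hlt⟩ := Metric.eventually_nhds_iff.1
    (hlim.eventually_lt_const (lt_add_of_pos_right 1 hε))
  refine ⟨δ / 3, by positivity, fun t ht => hlt ?_⟩
  rw [dist_zero_right, norm_of_nonneg (hd.perimeter_nonneg t), perimeter_eq d t 0]
  linarith [ht 0, ht (0 + 1), ht (0 + 2)]

end Stretch

theorem lt_of_monotone_of_ne_succ {α : Type*} [PartialOrder α] {b : ℕ → α} (hb : Monotone b)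
    {m n : ℕ} (hm : b m ≠ b (m + 1)) (hmn : m < n) : b 0 < b n :=
  (hb m.zero_le).trans_lt (((hb m.le_succ).lt_of_ne hm).trans_le (hb hmn))

/-! ### Hyperbolic geometry -/

section Hyperbolic

open Real

theorem cosh_eq_two_mul_cosh_half_sq (s : ℝ) : cosh s = 2 * cosh (s / 2) ^ 2 - 1 := by
  have h := cosh_two_mul (s / 2)
  rw [mul_div_cancel₀ s two_ne_zero, sinh_sq] at h
  linarith

theorem gram_cosh (a b c : ℝ) : gram (cosh a) (cosh b) (cosh c) =
    (cosh a - cosh (b - c)) * (cosh (b + c) - cosh a) := by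
  rw [gram, cosh_sub, cosh_add]
  linear_combination sinh c ^ 2 * cosh_sq b + (cosh b ^ 2 - 1) * cosh_sq c

theorem gram_cosh_nonneg {a b c : ℝ} (ha : a ≤ b + c) (hb : b ≤ c + a) (hc : c ≤ a + b) :
    0 ≤ gram (cosh a) (cosh b) (cosh c) := by
  rw [gram_cosh]
  apply mul_nonneg <;> rw [sub_nonneg, cosh_le_cosh]
  · exact abs_le_abs (by linarith) (by linarith)
  · exact abs_le_abs ha (by linarith)

theorem gram_cosh_pos {a b c : ℝ} (ha : a < b + c) (hb : b < c + a) (hc : c < a + b) :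
    0 < gram (cosh a) (cosh b) (cosh c) := by
  have ha0 : 0 < a := by linarith
  rw [gram_cosh]
  apply mul_pos <;> rw [sub_pos, cosh_lt_cosh, abs_of_pos ha0]
  · exact abs_lt.2 ⟨by linarith, by linarith⟩
  · exact lt_abs.2 (Or.inl ha)

theorem sinh_le_self_mul_cosh {s : ℝ} (hs : 0 ≤ s) : sinh s ≤ s * cosh s := by
  have hderiv (x : ℝ) : HasDerivAt (fun x => x * cosh x - sinh x) (x * sinh x) x := by
    refine (((hasDerivAt_id' x).fun_mul (hasDerivAt_cosh x)).fun_sub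
      (hasDerivAt_sinh x)).congr_deriv ?_
    ring
  have hmono : MonotoneOn (fun x => x * cosh x - sinh x) (Set.Ici 0) := by
    refine monotoneOn_of_hasDerivWithinAt_nonneg (convex_Ici 0)
      (fun x _ => (hderiv x).continuousAt.continuousWithinAt)
      (fun x _ => (hderiv x).hasDerivWithinAt) fun x hx => ?_
    rw [interior_Ici, Set.mem_Ioi] at hx
    exact mul_nonneg hx.le (sinh_nonneg_iff.2 hx.le)
  simpa using hmono Set.self_mem_Ici (Set.mem_Ici.2 hs) hs

theorem sinh_half_le_of_midline {a b c a' T : ℝ} (ha' : 0 ≤ a') (hb : cosh (b / 2) ≤ T)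
    (hc : cosh (c / 2) ≤ T)
    (hmid : 2 * cosh (b / 2) * cosh (c / 2) * cosh a' =
      cosh (a / 2) ^ 2 + cosh (b / 2) ^ 2 + cosh (c / 2) ^ 2 - 1) :
    sinh (a / 2) ≤ 2 * T * sinh (a' / 2) := by
  have hT : 0 ≤ T := (cosh_pos _).le.trans hb
  have hsinh : 0 ≤ sinh (a' / 2) := sinh_nonneg_iff.2 (by positivity)
  refine le_of_sq_le_sq ?_ (by positivity)
  calc sinh (a / 2) ^ 2
      = 4 * (cosh (b / 2) * cosh (c / 2)) * sinh (a' / 2) ^ 2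
        - (cosh (b / 2) - cosh (c / 2)) ^ 2 := by
        rw [cosh_eq_two_mul_cosh_half_sq a'] at hmid
        rw [sinh_sq, sinh_sq]
        linear_combination -hmid
    _ ≤ 4 * (cosh (b / 2) * cosh (c / 2)) * sinh (a' / 2) ^ 2 := by
        linarith [sq_nonneg (cosh (b / 2) - cosh (c / 2))]
    _ ≤ 4 * (T * T) * sinh (a' / 2) ^ 2 := by gcongr
    _ = (2 * T * sinh (a' / 2)) ^ 2 := by ring

variable {X : Type*} {d : X → X → ℝ}

theorem Nondegenerate.gramDet_cosh_pos {t : Fin 3 → X} (ht : Nondegenerate d t) :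
    0 < gramDet d cosh t :=
  gram_cosh_pos (ht 0) (ht 1) (ht 2)

namespace IsMedianGeometry

theorem gram_cosh_half_nonneg (hd : IsMedianGeometry d cosh) (t : Fin 3 → X) (i : Fin 3) :
    0 ≤ gram (cosh (side d t i / 2)) (cosh (side d t (i + 1) / 2))
      (cosh (side d t (i + 2) / 2)) := by
  obtain ⟨h11, h12, h21, h22⟩ := fin_three_add_add i
  have h0 := hd.side_le_add t i
  have h1 := hd.side_le_add t (i + 1)
  have h2 := hd.side_le_add t (i + 2)
  rw [h11, h12] at h1
  rw [h21, h22] at h2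
  apply gram_cosh_nonneg <;> linarith

theorem two_mul_side_le_side (hd : IsMedianGeometry d cosh) {p : Piece} {t t' : Fin 3 → X}
    (ht : IsPieceOf d p t t') (i : Fin 3) : 2 * side d t' i ≤ side d t i := by
  by_cases hp : IsParallelStep p i
  · have hgram := hd.gram_cosh_half_nonneg t i
    rw [hd.gram_half_sides ht hp] at hgram
    have hcosh := nonneg_of_mul_nonneg_right hgram (by positivity)
    rw [sub_nonneg, cosh_le_cosh, abs_of_nonneg (hd.side_nonneg t' i),
      abs_of_nonneg (div_nonneg (hd.side_nonneg t i) zero_le_two)] at hcosh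
    linarith
  · rw [hd.side_eq_half ht hp, mul_div_cancel₀ _ two_ne_zero]

theorem side_le_two_mul_side_mul_exp (hd : IsMedianGeometry d cosh) {p : Piece}
    {t t' : Fin 3 → X} (ht : IsPieceOf d p t t') (i : Fin 3) {r : ℝ}
    (hr : ∀ j, side d t j ≤ r) : side d t i ≤ 2 * side d t' i * exp (1 / 4 * r ^ 2) := by
  have ha := hd.side_nonneg t i
  have ha' := hd.side_nonneg t' i
  by_cases hp : IsParallelStep p i
  · have hcosh {s : ℝ} (h0 : 0 ≤ s) (hsr : s ≤ r) : cosh (s / 2) ≤ exp (1 / 8 * r ^ 2) :=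
      (cosh_le_exp_half_sq _).trans (exp_le_exp.2 (by nlinarith))
    have hexp : exp (1 / 4 * r ^ 2) = exp (1 / 8 * r ^ 2) * exp (1 / 8 * r ^ 2) := by
      rw [← exp_add]
      ring_nf
    have hsinh := sinh_half_le_of_midline ha' (hcosh (hd.side_nonneg t _) (hr _))
      (hcosh (hd.side_nonneg t _) (hr _)) (hd.side_midline ht hp)
    calc side d t i = 2 * (side d t i / 2) := by ring
      _ ≤ 2 * sinh (side d t i / 2) := by
          gcongr
          exact self_le_sinh_iff.2 (by positivity)
      _ ≤ 2 * (2 * exp (1 / 8 * r ^ 2) * sinh (side d t' i / 2)) := by gcongr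
      _ ≤ 2 * (2 * exp (1 / 8 * r ^ 2) * (side d t' i / 2 * exp (1 / 8 * r ^ 2))) := by
          gcongr
          refine (sinh_le_self_mul_cosh (by positivity)).trans ?_
          gcongr
          exact hcosh ha' (by linarith [hd.two_mul_side_le_side ht i, hr i])
      _ = 2 * side d t' i * exp (1 / 4 * r ^ 2) := by
          rw [hexp]
          ring
  · rw [hd.side_eq_half ht hp, mul_div_cancel₀ _ two_ne_zero]
    exact le_mul_of_one_le_right ha (one_le_exp (by positivity))

section Nested

variable {p : ℕ → Piece} {t : ℕ → Fin 3 → X}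

theorem antitone_two_pow_mul_side (hd : IsMedianGeometry d cosh) (ht : IsNested d p t)
    (i : Fin 3) : Antitone fun n => 2 ^ n * side d (t n) i :=
  antitone_two_pow_mul fun n => hd.two_mul_side_le_side (ht n) i

theorem two_pow_mul_side_le (hd : IsMedianGeometry d cosh) (ht : IsNested d p t)
    (i : Fin 3) (n : ℕ) : 2 ^ n * side d (t n) i ≤ side d (t 0) i := by
  simpa using hd.antitone_two_pow_mul_side ht i n.zero_le

theorem two_pow_mul_side_lt (hd : IsMedianGeometry d cosh) (ht : IsNested d p t)
    (h₀ : Nondegenerate d (t 0)) {i : Fin 3} {m n : ℕ} (hm : IsParallelStep (p m) i)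
    (hmn : m < n) : 2 ^ n * side d (t n) i < side d (t 0) i := by
  have hne := hd.side_ne_two_mul (ht m) hm
    (hd.gramDet_ne_zero_of_isNested ht h₀.gramDet_cosh_pos.ne' m)
  have hlt := lt_of_monotone_of_ne_succ (hd.antitone_two_pow_mul_side ht i).neg (m := m)
    (by simpa [pow_succ, mul_assoc] using hne) hmn
  simpa using hlt

theorem side_div_stretch_le_two_pow_mul_div_stretch (hd : IsMedianGeometry d cosh)
    (ht : IsNested d p t) (i : Fin 3) (n : ℕ) :
    side d (t 0) i / stretch (1 / 4) (1 / 2) (perimeter d (t 0)) ≤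
      2 ^ n * (side d (t n) i / stretch (1 / 4) (1 / 2) ((1 / 2) ^ n * perimeter d (t 0))) := by
  have hmono := monotone_two_pow_mul_div_stretch (by norm_num) fun n =>
    hd.side_le_two_mul_side_mul_exp (ht n) i
      (r := (1 / 2) ^ n * perimeter d (t 0)) fun j => by
        rw [one_div_pow, one_div_mul_eq_div, le_div_iff₀' (by positivity)]
        exact (hd.two_pow_mul_side_le ht j n).trans (hd.side_le_perimeter _ j)
  simpa using hmono n.zero_le

theorem side_div_stretch_le (hd : IsMedianGeometry d cosh) (ht : IsNested d p t)
    (i : Fin 3) (n : ℕ) :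
    side d (t 0) i / stretch (1 / 4) (1 / 2) (perimeter d (t 0)) ≤ 2 ^ n * side d (t n) i := by
  refine (hd.side_div_stretch_le_two_pow_mul_div_stretch ht i n).trans ?_
  gcongr
  exact div_le_self (hd.side_nonneg _ i) (one_le_stretch (by norm_num) (by norm_num))

theorem side_div_stretch_lt (hd : IsMedianGeometry d cosh) (ht : IsNested d p t)
    (h₀ : Nondegenerate d (t 0)) (i : Fin 3) (n : ℕ) :
    side d (t 0) i / stretch (1 / 4) (1 / 2) (perimeter d (t 0)) < 2 ^ n * side d (t n) i := by
  have hpos : 0 < side d (t n) i :=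
    pos_of_mul_pos_right ((div_pos (h₀.side_pos i) (stretch_pos _ _ _)).trans_le
      (hd.side_div_stretch_le ht i n)) (by positivity)
  have hr := h₀.perimeter_pos
  refine (hd.side_div_stretch_le_two_pow_mul_div_stretch ht i n).trans_lt ?_
  gcongr
  exact div_lt_self hpos (one_lt_stretch (by norm_num) (by norm_num) (by positivity))

end Nested

end IsMedianGeometry

/-- The Lorentzian form on `ℝ³` obtained by polarizing `p * n - q ^ 2` for `v = (p, q, n)`. -/
noncomputable def lorentzForm : LinearMap.BilinForm ℝ (ℝ × ℝ × ℝ) :=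
  LinearMap.mk₂ ℝ (fun v w => (v.1 * w.2.2 + v.2.2 * w.1) / 2 - v.2.1 * w.2.1)
    (fun _ _ _ => by simp only [Prod.fst_add, Prod.snd_add]; ring)
    (fun _ _ _ => by simp only [Prod.smul_fst, Prod.smul_snd, smul_eq_mul]; ring)
    (fun _ _ _ => by simp only [Prod.fst_add, Prod.snd_add]; ring)
    (fun _ _ _ => by simp only [Prod.smul_fst, Prod.smul_snd, smul_eq_mul]; ring)

theorem lorentzForm_apply (v w : ℝ × ℝ × ℝ) :
    lorentzForm v w = (v.1 * w.2.2 + v.2.2 * w.1) / 2 - v.2.1 * w.2.1 :=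
  rfl

theorem eq_zero_of_lorentzForm_eq_zero {v w : ℝ × ℝ × ℝ} (hv : lorentzForm v v = 1)
    (hvw : lorentzForm v w = 0) (hww : lorentzForm w w = 0) : w = 0 := by
  obtain ⟨p, q, n⟩ := v
  obtain ⟨a, b, c⟩ := w
  simp only [lorentzForm_apply] at hv hvw hww
  have hsq : (a * n - c * p) ^ 2 + (2 * b) ^ 2 = 0 := by
    linear_combination (2 * a * n + 2 * c * p + 4 * b * q) * hvw - 4 * b ^ 2 * hv
      - 4 * p * n * hww
  have hac : a * n - c * p = 0 := by nlinarith
  have hb : b = 0 := by nlinarith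
  subst hb
  have hpn : 0 < p * n := by nlinarith [sq_nonneg q]
  have han : a * n = 0 := by linarith
  have hcp : c * p = 0 := by linarith
  have ha : a = 0 := (mul_eq_zero.1 han).resolve_right (right_ne_zero_of_mul hpn.ne')
  have hc : c = 0 := (mul_eq_zero.1 hcp).resolve_right (left_ne_zero_of_mul hpn.ne')
  rw [ha, hc, Prod.mk_zero_zero, Prod.mk_zero_zero]

/-- The point of the hyperboloid `p * n - q ^ 2 = 1` that represents `z`: the coefficients of the
quadratic polynomial `p * x ^ 2 - 2 * q * x + n` of discriminant `-4` with root `z`. -/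
noncomputable def toHyperboloid (z : UpperHalfPlane) : ℝ × ℝ × ℝ :=
  (1 / z.im, z.re / z.im, (z.re ^ 2 + z.im ^ 2) / z.im)

theorem isQuadricModel_toHyperboloid :
    IsQuadricModel lorentzForm toHyperboloid (dist : UpperHalfPlane → UpperHalfPlane → ℝ) cosh := by
  have hself (z : UpperHalfPlane) : lorentzForm (toHyperboloid z) (toHyperboloid z) = 1 := by
    have := z.im_ne_zero
    simp only [lorentzForm_apply, toHyperboloid]
    field_simp
    ring
  exact {
    form_symm := fun v w => by
      simp only [lorentzForm_apply]
      ring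
    form_self := hself
    form_eq := fun z w => by
      have := z.im_ne_zero
      have := w.im_ne_zero
      rw [UpperHalfPlane.cosh_dist']
      simp only [lorentzForm_apply, toHyperboloid]
      field_simp
      ring
    definite := fun z w => eq_zero_of_lorentzForm_eq_zero (hself z)
    symm := dist_comm
    triangle := dist_triangle
    double := cosh_eq_two_mul_cosh_half_sq }

end Hyperbolic

/-! ### Spherical geometry -/

section Spherical

open Real InnerProductGeometry Metric

theorem cos_eq_two_mul_cos_half_sq (s : ℝ) : cos s = 2 * cos (s / 2) ^ 2 - 1 := by
  rw [← cos_two_mul, mul_div_cancel₀ s two_ne_zero]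

theorem gram_cos (a b c : ℝ) : gram (cos a) (cos b) (cos c) =
    4 * sin ((a + b + c) / 2) * sin ((b + c - a) / 2) * sin ((c + a - b) / 2) *
      sin ((a + b - c) / 2) := by
  have hadd : cos a - cos (b + c) = 2 * sin ((a + b + c) / 2) * sin ((b + c - a) / 2) := by
    rw [cos_sub_cos, ← add_assoc, ← neg_sub (b + c) a, neg_div, sin_neg]
    ring
  have hsub : cos (b - c) - cos a = 2 * sin ((a + b - c) / 2) * sin ((c + a - b) / 2) := by
    rw [cos_sub_cos, show b - c + a = a + b - c by ring,
      show b - c - a = -(c + a - b) by ring, neg_div, sin_neg]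
    ring
  calc gram (cos a) (cos b) (cos c)
      = (cos a - cos (b + c)) * (cos (b - c) - cos a) := by
        rw [gram, cos_sub, cos_add]
        linear_combination (cos b ^ 2 - 1) * sin_sq_add_cos_sq c - sin c ^ 2 * sin_sq_add_cos_sq b
    _ = _ := by
        rw [hadd, hsub]
        ring

theorem gram_cos_nonneg {a b c : ℝ} (ha : a ≤ b + c) (hb : b ≤ c + a) (hc : c ≤ a + b)
    (habc : a + b + c ≤ 2 * π) : 0 ≤ gram (cos a) (cos b) (cos c) := by
  have hsin {s : ℝ} (h0 : 0 ≤ s) (hs : s ≤ a + b + c) : 0 ≤ sin (s / 2) :=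
    sin_nonneg_of_nonneg_of_le_pi (by linarith) (by linarith)
  rw [gram_cos]
  have h := hsin (s := a + b + c) (by linarith) le_rfl
  have h1 := hsin (s := b + c - a) (by linarith) (by linarith)
  have h2 := hsin (s := c + a - b) (by linarith) (by linarith)
  have h3 := hsin (s := a + b - c) (by linarith) (by linarith)
  positivity

theorem gram_cos_pos {a b c : ℝ} (ha : a < b + c) (hb : b < c + a) (hc : c < a + b)
    (habc : a + b + c < 2 * π) : 0 < gram (cos a) (cos b) (cos c) := by
  have hsin {s : ℝ} (h0 : 0 < s) (hs : s ≤ a + b + c) : 0 < sin (s / 2) :=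
    sin_pos_of_pos_of_lt_pi (by linarith) (by linarith)
  rw [gram_cos]
  have h := hsin (s := a + b + c) (by linarith) le_rfl
  have h1 := hsin (s := b + c - a) (by linarith) (by linarith)
  have h2 := hsin (s := c + a - b) (by linarith) (by linarith)
  have h3 := hsin (s := a + b - c) (by linarith) (by linarith)
  positivity

theorem two_mul_sin_half_le_of_midline {a b c a' T : ℝ} (hT : 0 ≤ T)
    (hb : 1 ≤ cos (b / 2) * T) (hc : 1 ≤ cos (c / 2) * T) (ha : 0 ≤ sin (a / 2))
    (hmid : 2 * cos (b / 2) * cos (c / 2) * cos a' =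
      cos (a / 2) ^ 2 + cos (b / 2) ^ 2 + cos (c / 2) ^ 2 - 1) :
    2 * sin (a' / 2) ≤ T * sin (a / 2) := by
  have hsin : 4 * (cos (b / 2) * cos (c / 2)) * sin (a' / 2) ^ 2 =
      sin (a / 2) ^ 2 - (cos (b / 2) - cos (c / 2)) ^ 2 := by
    rw [cos_eq_two_mul_cos_half_sq a'] at hmid
    rw [sin_sq, sin_sq]
    linear_combination -hmid
  refine le_of_sq_le_sq ?_ (by positivity)
  calc (2 * sin (a' / 2)) ^ 2
      ≤ (cos (b / 2) * T) * (cos (c / 2) * T) * (2 * sin (a' / 2)) ^ 2 :=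
        le_mul_of_one_le_left (sq_nonneg _) (one_le_mul_of_one_le_of_one_le hb hc)
    _ = T ^ 2 * (sin (a / 2) ^ 2 - (cos (b / 2) - cos (c / 2)) ^ 2) := by
        rw [← hsin]
        ring
    _ ≤ T ^ 2 * sin (a / 2) ^ 2 := by
        gcongr
        exact sub_le_self _ (sq_nonneg _)
    _ = (T * sin (a / 2)) ^ 2 := by ring

theorem mul_cos_le_sin {s : ℝ} (h0 : 0 ≤ s) (hs : s < π / 2) : s * cos s ≤ sin s := by
  rw [← le_div_iff₀ (cos_pos_of_mem_Ioo ⟨by linarith, hs⟩), ← tan_eq_sin_div_cos]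
  exact le_tan h0 hs

theorem two_mul_le_mul_of_sin_half_le {a a' T : ℝ} (hT : 0 ≤ T) (ha : 0 ≤ a) (ha' : 0 ≤ a')
    (hπ : a' < π) (hcos : 1 ≤ cos (a' / 2) * T) (hsin : 2 * sin (a' / 2) ≤ T * sin (a / 2)) :
    2 * a' ≤ a * (T * T) :=
  calc 2 * a' ≤ 2 * a' * (cos (a' / 2) * T) := le_mul_of_one_le_right (by positivity) hcos
    _ = 4 * T * (a' / 2 * cos (a' / 2)) := by ring
    _ ≤ 4 * T * sin (a' / 2) := by
        gcongr
        exact mul_cos_le_sin (by positivity) ((div_lt_div_iff_of_pos_right two_pos).2 hπ)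
    _ = 2 * T * (2 * sin (a' / 2)) := by ring
    _ ≤ 2 * T * (T * sin (a / 2)) := mul_le_mul_of_nonneg_left hsin (by positivity)
    _ ≤ 2 * T * (T * (a / 2)) := by
        gcongr
        exact sin_le (by positivity)
    _ = a * (T * T) := by ring

variable {V : Type*} [NormedAddCommGroup V] [InnerProductSpace ℝ V]

/-- The great-circle distance of the unit sphere. -/
noncomputable def sphAngle (x y : sphere (0 : V) 1) : ℝ :=
  angle (x : V) y

theorem sphAngle_nonneg (x y : sphere (0 : V) 1) : 0 ≤ sphAngle x y :=
  angle_nonneg _ _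

theorem sphAngle_le_pi (x y : sphere (0 : V) 1) : sphAngle x y ≤ π :=
  angle_le_pi _ _

theorem inner_eq_cos_sphAngle (x y : sphere (0 : V) 1) :
    inner ℝ (x : V) y = cos (sphAngle x y) :=
  inner_eq_cos_angle_of_norm_eq_one (norm_eq_of_mem_sphere x) (norm_eq_of_mem_sphere y)

theorem isQuadricModel_sphere :
    IsQuadricModel (innerₗ V) (fun x : sphere (0 : V) 1 => (x : V)) sphAngle cos where
  form_symm v w := real_inner_comm w v
  form_self x := inner_self_eq_one_of_norm_eq_one (norm_eq_of_mem_sphere x)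
  form_eq := inner_eq_cos_sphAngle
  definite _ _ _ h := inner_self_eq_zero.1 h
  symm _ _ := angle_comm _ _
  triangle _ _ _ := angle_le_angle_add_angle _ _ _
  double := cos_eq_two_mul_cos_half_sq

theorem isMedianGeometry_sphAngle : IsMedianGeometry (sphAngle (V := V)) cos :=
  isQuadricModel_sphere.isMedianGeometry

theorem cos_half_sphAngle_nonneg (x y : sphere (0 : V) 1) : 0 ≤ cos (sphAngle x y / 2) :=
  cos_nonneg_of_neg_pi_div_two_le_of_le (by linarith [sphAngle_nonneg x y, pi_pos])
    (by linarith [sphAngle_le_pi x y])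

theorem sin_half_sphAngle_nonneg (x y : sphere (0 : V) 1) : 0 ≤ sin (sphAngle x y / 2) :=
  sin_nonneg_of_nonneg_of_le_pi (by linarith [sphAngle_nonneg x y])
    (by linarith [sphAngle_le_pi x y, pi_pos])

theorem norm_add_sphere (x y : sphere (0 : V) 1) :
    ‖(x : V) + y‖ = 2 * cos (sphAngle x y / 2) := by
  rw [← sq_eq_sq₀ (norm_nonneg _) (mul_nonneg zero_le_two (cos_half_sphAngle_nonneg x y)),
    norm_add_sq_real, norm_eq_of_mem_sphere, norm_eq_of_mem_sphere, inner_eq_cos_sphAngle,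
    cos_eq_two_mul_cos_half_sq]
  ring

theorem norm_sub_sphere (x y : sphere (0 : V) 1) :
    ‖(x : V) - y‖ = 2 * sin (sphAngle x y / 2) := by
  rw [← sq_eq_sq₀ (norm_nonneg _) (mul_nonneg zero_le_two (sin_half_sphAngle_nonneg x y)),
    norm_sub_sq_real, norm_eq_of_mem_sphere, norm_eq_of_mem_sphere, inner_eq_cos_sphAngle,
    cos_eq_two_mul_cos_half_sq, mul_pow, sin_sq]
  ring

theorem norm_sub_le_sphAngle (x y : sphere (0 : V) 1) : ‖(x : V) - y‖ ≤ sphAngle x y := by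
  rw [norm_sub_sphere]
  linarith [sin_le (div_nonneg (sphAngle_nonneg x y) zero_le_two)]

/-- The vertices of `t` lie in a common open hemisphere. -/
def InHemisphere (t : Fin 3 → sphere (0 : V) 1) : Prop :=
  ∃ u : V, ∀ i, 0 < inner ℝ u (t i : V)

theorem InHemisphere.perimeter_lt {t : Fin 3 → sphere (0 : V) 1} (ht : InHemisphere t) :
    perimeter sphAngle t < 2 * π := by
  obtain ⟨u, hu⟩ := ht
  -- equality would put `-t 0` on a geodesic from `t 1` to `t 2`, hence in the hemisphere
  have hne : angle (t 1 : V) (t 2) ≠ angle (t 1 : V) (-t 0) + angle (-t 0 : V) (t 2) := by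
    rw [Ne, angle_eq_angle_add_angle_iff (neg_ne_zero.2 (ne_zero_of_mem_unit_sphere _))]
    rintro (hpi | hspan)
    · obtain ⟨-, r, hr, h⟩ := angle_eq_pi_iff.1 hpi
      have h2 := hu 2
      rw [h, inner_smul_right] at h2
      exact (mul_neg_of_neg_of_pos hr (hu 1)).not_gt h2
    · obtain ⟨a, b, hab⟩ := Submodule.mem_span_pair.1 hspan
      have h := congrArg (inner ℝ u) hab
      simp only [NNReal.smul_def, inner_add_right, inner_smul_right, inner_neg_right] at h
      linarith [mul_nonneg a.coe_nonneg (hu 1).le, mul_nonneg b.coe_nonneg (hu 2).le, hu 0]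
  have hlt := (angle_le_angle_add_angle _ _ _).lt_of_ne hne
  rw [angle_neg_right, angle_neg_left, angle_comm (t 1 : V) (t 0),
    angle_comm (t 0 : V) (t 2)] at hlt
  have hperimeter : perimeter sphAngle t =
      angle (t 1 : V) (t 2) + angle (t 2 : V) (t 0) + angle (t 0 : V) (t 1) :=
    perimeter_eq _ t 0
  linarith

theorem Nondegenerate.gramDet_cos_pos {t : Fin 3 → sphere (0 : V) 1}
    (ht : Nondegenerate sphAngle t) (h : InHemisphere t) : 0 < gramDet sphAngle cos t :=
  gram_cos_pos (ht 0) (ht 1) (ht 2) ((perimeter_eq _ t 0).symm.trans_lt h.perimeter_lt)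

theorem gram_cos_half_side_nonneg (t : Fin 3 → sphere (0 : V) 1) (i : Fin 3) :
    0 ≤ gram (cos (side sphAngle t i / 2)) (cos (side sphAngle t (i + 1) / 2))
      (cos (side sphAngle t (i + 2) / 2)) := by
  obtain ⟨h11, h12, h21, h22⟩ := fin_three_add_add i
  have h0 := isMedianGeometry_sphAngle.side_le_add t i
  have h1 := isMedianGeometry_sphAngle.side_le_add t (i + 1)
  have h2 := isMedianGeometry_sphAngle.side_le_add t (i + 2)
  rw [h11, h12] at h1
  rw [h21, h22] at h2
  have hpi (j : Fin 3) : side sphAngle t j ≤ π := sphAngle_le_pi _ _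
  apply gram_cos_nonneg <;> linarith [hpi i, hpi (i + 1), hpi (i + 2), pi_pos]

/-! ### Central projection of a spherical cap -/

/-- `z` is `x` or the midpoint of `x` and `y`. -/
def IsStartOrMidpoint {X : Type*} (d : X → X → ℝ) (x y z : X) : Prop :=
  z = x ∨ IsMidpoint d x y z

theorem IsPieceOf.exists_isStartOrMidpoint {X : Type*} {d : X → X → ℝ} {C : ℝ → ℝ}
    (hd : IsMedianGeometry d C) {p : Piece} {t t' : Fin 3 → X} (ht : IsPieceOf d p t t')
    (i j : Fin 3) :
    ∃ k a b, IsStartOrMidpoint d (t k) (t a) (t' i) ∧ IsStartOrMidpoint d (t k) (t b) (t' j) := by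
  cases p with
  | inner =>
    have hmid {i k : Fin 3} (hk : k ≠ i) : ∃ a, IsStartOrMidpoint d (t k) (t a) (t' i) := by
      obtain rfl | rfl : k = i + 1 ∨ k = i + 2 := by
        clear ht
        decide +revert
      · exact ⟨_, Or.inr (ht i)⟩
      · exact ⟨_, Or.inr (hd.isMidpoint_symm (ht i))⟩
    obtain ⟨k, hi, hj⟩ : ∃ k : Fin 3, k ≠ i ∧ k ≠ j := by
      clear ht
      decide +revert
    obtain ⟨a, ha⟩ := hmid hi
    obtain ⟨b, hb⟩ := hmid hj
    exact ⟨k, a, b, ha, hb⟩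
  | corner k =>
    have hstart (i : Fin 3) : IsStartOrMidpoint d (t k) (t i) (t' i) := by
      rcases eq_or_ne i k with rfl | hi
      · exact Or.inl ht.1
      · exact Or.inr (ht.2 i hi)
    exact ⟨k, i, j, hstart i, hstart j⟩

theorem IsMedianGeometry.dist_vertices_le_perimeter {X : Type*} {d : X → X → ℝ} {C : ℝ → ℝ}
    (hd : IsMedianGeometry d C) (t : Fin 3 → X) (i j : Fin 3) :
    d (t i) (t j) ≤ perimeter d t := by
  obtain ⟨h11, h12, h21, h22⟩ := fin_three_add_add i
  obtain rfl | rfl | rfl : j = i ∨ j = i + 1 ∨ j = i + 2 := by decide +revert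
  · have h1 := hd.triangle (t j) (t (j + 1)) (t j)
    have h2 := hd.triangle (t j) (t (j + 2)) (t j)
    rw [hd.symm (t (j + 1))] at h1
    rw [hd.symm (t j) (t (j + 2))] at h2
    rw [perimeter_eq d t j, side, side, side, h11, h12, h21, h22]
    linarith [hd.nonneg (t (j + 1)) (t (j + 2))]
  · have h := hd.side_le_perimeter t (i + 2)
    rwa [side, h21, h22] at h
  · have h := hd.side_le_perimeter t (i + 1)
    rwa [side, h11, h12, hd.symm] at h

theorem dist_lineMap_lineMap_le {x y z : V} {s s' q r : ℝ} (hs : 0 ≤ s) (hs' : 0 ≤ s')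
    (hsq : s ≤ q) (hsq' : s' ≤ q) (hxy : dist x y ≤ r) (hxz : dist x z ≤ r)
    (hyz : dist y z ≤ r) :
    dist (AffineMap.lineMap x y s) (AffineMap.lineMap x z s') ≤ q * r := by
  wlog hle : s' ≤ s generalizing y z s s'
  · rw [dist_comm]
    exact this hs' hs hsq' hsq hxz hxy (by rwa [dist_comm]) (le_of_not_ge hle)
  have hhom : dist (AffineMap.lineMap x y s') (AffineMap.lineMap x z s') = s' * dist y z := by
    rw [dist_eq_norm, dist_eq_norm, ← norm_smul_of_nonneg hs', AffineMap.lineMap_apply_module',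
      AffineMap.lineMap_apply_module']
    congr 1
    module
  calc dist (AffineMap.lineMap x y s) (AffineMap.lineMap x z s')
      ≤ dist (AffineMap.lineMap x y s) (AffineMap.lineMap x y s') +
          dist (AffineMap.lineMap x y s') (AffineMap.lineMap x z s') := dist_triangle _ _ _
    _ = (s - s') * dist x y + s' * dist y z := by
        rw [dist_lineMap_lineMap, dist_eq, abs_of_nonneg (sub_nonneg.2 hle), hhom]
    _ ≤ (s - s') * r + s' * r := by
        have := sub_nonneg.2 hle
        gcongr
    _ = s * r := by ring
    _ ≤ q * r := mul_le_mul_of_nonneg_right hsq (dist_nonneg.trans hxy)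

variable (V) in
/-- A closed cap of the unit sphere that is contained in an open hemisphere. -/
structure Cap where
  /-- The centre of the cap. -/
  pole : V
  /-- The minimal inner product of a point of the cap with the centre. -/
  height : ℝ
  norm_pole : ‖pole‖ = 1
  height_pos : 0 < height

namespace Cap

/-- The points of a cap. -/
def carrier (K : Cap V) : Set (sphere (0 : V) 1) :=
  {x | K.height ≤ inner ℝ K.pole (x : V)}

/-- The central projection to the tangent plane of the sphere at the pole. -/
noncomputable def gnomonic (K : Cap V) (x : sphere (0 : V) 1) : V :=
  (inner ℝ K.pole (x : V))⁻¹ • (x : V)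

variable {K : Cap V} {x y z : sphere (0 : V) 1}

theorem inner_pole_pos (hx : x ∈ K.carrier) : 0 < inner ℝ K.pole (x : V) :=
  K.height_pos.trans_le hx

theorem inner_pole_le_one (K : Cap V) (x : sphere (0 : V) 1) : inner ℝ K.pole (x : V) ≤ 1 := by
  simpa [K.norm_pole] using real_inner_le_norm K.pole (x : V)

theorem height_le_one (hx : x ∈ K.carrier) : K.height ≤ 1 :=
  le_trans hx (K.inner_pole_le_one x)

theorem height_le_cos_half (hx : x ∈ K.carrier) (hy : y ∈ K.carrier) :
    K.height ≤ cos (sphAngle x y / 2) := by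
  have h := real_inner_le_norm K.pole ((x : V) + y)
  rw [K.norm_pole, one_mul, norm_add_sphere, inner_add_right] at h
  have hx' : K.height ≤ inner ℝ K.pole (x : V) := hx
  have hy' : K.height ≤ inner ℝ K.pole (y : V) := hy
  linarith

theorem cos_half_pos (hx : x ∈ K.carrier) (hy : y ∈ K.carrier) : 0 < cos (sphAngle x y / 2) :=
  K.height_pos.trans_le (height_le_cos_half hx hy)

theorem sphAngle_lt_pi (hx : x ∈ K.carrier) (hy : y ∈ K.carrier) : sphAngle x y < π := by
  refine (sphAngle_le_pi x y).lt_of_ne fun h => (cos_half_pos hx hy).ne' ?_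
  rw [h, cos_pi_div_two]

theorem inner_pole_midpoint (K : Cap V) (hz : IsMidpoint sphAngle x y z) :
    inner ℝ K.pole (x : V) + inner ℝ K.pole (y : V) =
      2 * cos (sphAngle x y / 2) * inner ℝ K.pole (z : V) := by
  rw [← inner_add_right, isQuadricModel_sphere.add_eq_smul_midpoint hz, inner_smul_right]

theorem midpoint_mem (hx : x ∈ K.carrier) (hy : y ∈ K.carrier)
    (hz : IsMidpoint sphAngle x y z) : z ∈ K.carrier := by
  have hsum : 2 * K.height ≤ 2 * cos (sphAngle x y / 2) * inner ℝ K.pole (z : V) := by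
    rw [← K.inner_pole_midpoint hz, two_mul]
    exact add_le_add hx hy
  have hcos := cos_half_pos hx hy
  have hz0 : 0 < inner ℝ K.pole (z : V) :=
    pos_of_mul_pos_right ((mul_pos two_pos K.height_pos).trans_le hsum) (by positivity)
  change K.height ≤ inner ℝ K.pole (z : V)
  nlinarith [cos_le_one (sphAngle x y / 2)]

theorem gnomonic_midpoint (hx : x ∈ K.carrier) (hy : y ∈ K.carrier)
    (hz : IsMidpoint sphAngle x y z) :
    K.gnomonic z = AffineMap.lineMap (K.gnomonic x) (K.gnomonic y)
      (inner ℝ K.pole (y : V) / (inner ℝ K.pole (x : V) + inner ℝ K.pole (y : V))) := by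
  have hx0 := inner_pole_pos hx
  have hy0 := inner_pole_pos hy
  have hcos := cos_half_pos hx hy
  have hz0 := inner_pole_pos (midpoint_mem hx hy hz)
  have hadd : K.gnomonic z =
      (inner ℝ K.pole (x : V) + inner ℝ K.pole (y : V))⁻¹ • ((x : V) + y) := by
    rw [K.inner_pole_midpoint hz, isQuadricModel_sphere.add_eq_smul_midpoint hz, smul_smul,
      gnomonic]
    congr 1
    field_simp
  rw [hadd, AffineMap.lineMap_apply_module, gnomonic, gnomonic, smul_smul, smul_smul, smul_add]
  congr 2 <;> field_simp
  ring

theorem exists_gnomonic_eq_lineMap (hx : x ∈ K.carrier) (hy : y ∈ K.carrier)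
    (hz : IsStartOrMidpoint sphAngle x y z) :
    ∃ s, 0 ≤ s ∧ s ≤ 1 / (1 + K.height) ∧
      K.gnomonic z = AffineMap.lineMap (K.gnomonic x) (K.gnomonic y) s := by
  have hm := K.height_pos
  rcases hz with rfl | hz
  · exact ⟨0, le_rfl, by positivity, (AffineMap.lineMap_apply_zero _ _).symm⟩
  · have hx0 := inner_pole_pos hx
    have hy0 := inner_pole_pos hy
    refine ⟨_, by positivity, ?_, gnomonic_midpoint hx hy hz⟩
    rw [div_le_div_iff₀ (by positivity) (by positivity)]
    have hx' : K.height ≤ inner ℝ K.pole (x : V) := hx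
    nlinarith [K.inner_pole_le_one y]

theorem norm_sub_le_dist_gnomonic (hx : x ∈ K.carrier) (hy : y ∈ K.carrier) :
    ‖(x : V) - y‖ ≤ dist (K.gnomonic x) (K.gnomonic y) := by
  have ha := one_le_inv_iff₀.2 ⟨inner_pole_pos hx, K.inner_pole_le_one x⟩
  have hb := one_le_inv_iff₀.2 ⟨inner_pole_pos hy, K.inner_pole_le_one y⟩
  have hab := one_le_mul_of_one_le_of_one_le ha hb
  rw [dist_eq_norm]
  refine le_of_sq_le_sq ?_ (norm_nonneg _)
  rw [norm_sub_sq_real, norm_sub_sq_real, gnomonic, gnomonic, norm_smul, norm_smul,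
    norm_eq_of_mem_sphere, norm_eq_of_mem_sphere, mul_one, mul_one, norm_eq_abs, norm_eq_abs,
    sq_abs, sq_abs, real_inner_smul_left, real_inner_smul_right, inner_eq_cos_sphAngle]
  nlinarith [sq_nonneg ((inner ℝ K.pole (x : V))⁻¹ - (inner ℝ K.pole (y : V))⁻¹),
    mul_nonneg (sub_nonneg.2 hab) (sub_nonneg.2 (cos_le_one (sphAngle x y)))]

theorem dist_gnomonic_le (hx : x ∈ K.carrier) (hy : y ∈ K.carrier) :
    dist (K.gnomonic x) (K.gnomonic y) ≤ 2 / K.height ^ 2 * sphAngle x y := by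
  have hm := K.height_pos
  have hx0 := inner_pole_pos hx
  have hy0 := inner_pole_pos hy
  have hfst : (inner ℝ K.pole (x : V))⁻¹ ≤ 1 / K.height ^ 2 := by
    rw [inv_eq_one_div]
    have hx' : K.height ≤ inner ℝ K.pole (x : V) := hx
    gcongr
    nlinarith [height_le_one hx]
  have hsnd : |(inner ℝ K.pole (x : V))⁻¹ - (inner ℝ K.pole (y : V))⁻¹| ≤
      1 / K.height ^ 2 * ‖(x : V) - y‖ := by
    have hinner : |inner ℝ K.pole (y : V) - inner ℝ K.pole (x : V)| ≤ ‖(x : V) - y‖ := by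
      rw [← inner_sub_right, norm_sub_rev]
      simpa [K.norm_pole] using abs_real_inner_le_norm K.pole ((y : V) - x)
    rw [inv_sub_inv hx0.ne' hy0.ne', abs_div, abs_of_pos (mul_pos hx0 hy0),
      one_div_mul_eq_div, sq]
    exact div_le_div₀ (norm_nonneg _) hinner (by positivity) (mul_le_mul hx hy hm.le hx0.le)
  have hdecomp : K.gnomonic x - K.gnomonic y =
      (inner ℝ K.pole (x : V))⁻¹ • ((x : V) - y) +
        ((inner ℝ K.pole (x : V))⁻¹ - (inner ℝ K.pole (y : V))⁻¹) • (y : V) := by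
    rw [gnomonic, gnomonic]
    module
  calc dist (K.gnomonic x) (K.gnomonic y)
      ≤ (inner ℝ K.pole (x : V))⁻¹ * ‖(x : V) - y‖ +
          |(inner ℝ K.pole (x : V))⁻¹ - (inner ℝ K.pole (y : V))⁻¹| := by
        rw [dist_eq_norm, hdecomp]
        refine (norm_add_le _ _).trans_eq ?_
        rw [norm_smul_of_nonneg (inv_nonneg.2 hx0.le), norm_smul, norm_eq_of_mem_sphere, mul_one,
          norm_eq_abs]
    _ ≤ 1 / K.height ^ 2 * ‖(x : V) - y‖ + 1 / K.height ^ 2 * ‖(x : V) - y‖ := by gcongr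
    _ = 2 / K.height ^ 2 * ‖(x : V) - y‖ := by ring
    _ ≤ 2 / K.height ^ 2 * sphAngle x y := by
        gcongr
        exact norm_sub_le_sphAngle x y

theorem one_le_cos_half_mul_exp (hx : x ∈ K.carrier) (hy : y ∈ K.carrier) {r : ℝ}
    (hr : dist (K.gnomonic x) (K.gnomonic y) ≤ r) :
    1 ≤ cos (sphAngle x y / 2) * exp (1 / (8 * K.height ^ 2) * r ^ 2) := by
  have hm := K.height_pos
  have hcos := height_le_cos_half hx hy
  have hchord : (2 * sin (sphAngle x y / 2)) ^ 2 ≤ r ^ 2 := by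
    rw [← norm_sub_sphere]
    gcongr
    exact (norm_sub_le_dist_gnomonic hx hy).trans hr
  have hexp : exp (1 / (8 * K.height ^ 2) * r ^ 2) ^ 2 = exp (r ^ 2 / (4 * K.height ^ 2)) := by
    rw [← exp_nat_mul]
    congr 1
    push_cast
    field_simp
    ring
  refine le_of_sq_le_sq ?_ (mul_nonneg (cos_half_sphAngle_nonneg x y) (exp_pos _).le)
  calc (1 : ℝ) ^ 2
      = cos (sphAngle x y / 2) ^ 2 + sin (sphAngle x y / 2) ^ 2 := by
        rw [cos_sq_add_sin_sq, one_pow]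
    _ ≤ cos (sphAngle x y / 2) ^ 2 + K.height ^ 2 * (r ^ 2 / (4 * K.height ^ 2)) := by
        have : K.height ^ 2 * (r ^ 2 / (4 * K.height ^ 2)) = r ^ 2 / 4 := by field_simp
        linarith
    _ ≤ cos (sphAngle x y / 2) ^ 2 +
          cos (sphAngle x y / 2) ^ 2 * (r ^ 2 / (4 * K.height ^ 2)) := by gcongr
    _ = cos (sphAngle x y / 2) ^ 2 * (r ^ 2 / (4 * K.height ^ 2) + 1) := by ring
    _ ≤ cos (sphAngle x y / 2) ^ 2 * exp (r ^ 2 / (4 * K.height ^ 2)) := by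
        gcongr
        exact add_one_le_exp _
    _ = (cos (sphAngle x y / 2) * exp (1 / (8 * K.height ^ 2) * r ^ 2)) ^ 2 := by
        rw [mul_pow, hexp]

end Cap

/-! ### Nested triangles in a cap -/

section Nested

variable {K : Cap V} {p : Piece} {t t' : Fin 3 → sphere (0 : V) 1}

namespace IsPieceOf

theorem mem_cap (ht : IsPieceOf sphAngle p t t') (hK : ∀ i, t i ∈ K.carrier) (i : Fin 3) :
    t' i ∈ K.carrier := by
  obtain ⟨k, a, -, hi | hi, -⟩ := ht.exists_isStartOrMidpoint isMedianGeometry_sphAngle i i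
  · rw [hi]
    exact hK k
  · exact Cap.midpoint_mem (hK k) (hK a) hi

theorem dist_gnomonic_le (ht : IsPieceOf sphAngle p t t') (hK : ∀ i, t i ∈ K.carrier) {r : ℝ}
    (hr : ∀ i j, dist (K.gnomonic (t i)) (K.gnomonic (t j)) ≤ r) (i j : Fin 3) :
    dist (K.gnomonic (t' i)) (K.gnomonic (t' j)) ≤ 1 / (1 + K.height) * r := by
  obtain ⟨k, a, b, hi, hj⟩ := ht.exists_isStartOrMidpoint isMedianGeometry_sphAngle i j
  obtain ⟨s, hs, hsq, hi⟩ := Cap.exists_gnomonic_eq_lineMap (hK k) (hK a) hi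
  obtain ⟨s', hs', hsq', hj⟩ := Cap.exists_gnomonic_eq_lineMap (hK k) (hK b) hj
  rw [hi, hj]
  exact dist_lineMap_lineMap_le hs hs' hsq hsq' (hr _ _) (hr _ _) (hr _ _)

theorem side_le_two_mul_side (ht : IsPieceOf sphAngle p t t') (hK : ∀ i, t i ∈ K.carrier)
    (i : Fin 3) : side sphAngle t i ≤ 2 * side sphAngle t' i := by
  by_cases hp : IsParallelStep p i
  · have hpos (j : Fin 3) : 0 < cos (side sphAngle t j / 2) := Cap.cos_half_pos (hK _) (hK _)
    have hgram := gram_cos_half_side_nonneg t i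
    rw [isMedianGeometry_sphAngle.gram_half_sides ht hp] at hgram
    have hcos := nonneg_of_mul_nonneg_right hgram
      (mul_pos (mul_pos two_pos (hpos (i + 1))) (hpos (i + 2)))
    have ha' : 0 ≤ side sphAngle t' i := sphAngle_nonneg _ _
    have hpi : side sphAngle t i ≤ π := sphAngle_le_pi _ _
    by_contra! hlt
    have := cos_lt_cos_of_nonneg_of_le_pi ha' (by linarith [pi_pos])
      ((lt_div_iff₀' two_pos).2 hlt)
    linarith
  · rw [isMedianGeometry_sphAngle.side_eq_half ht hp, mul_div_cancel₀ _ two_ne_zero]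

theorem two_mul_side_le_side_mul_exp (ht : IsPieceOf sphAngle p t t')
    (hK : ∀ i, t i ∈ K.carrier) {r : ℝ}
    (hr : ∀ i j, dist (K.gnomonic (t i)) (K.gnomonic (t j)) ≤ r) (i : Fin 3) :
    2 * side sphAngle t' i ≤ side sphAngle t i * exp (1 / (4 * K.height ^ 2) * r ^ 2) := by
  by_cases hp : IsParallelStep p i
  · have hK' := ht.mem_cap hK
    have hr' (i j : Fin 3) : dist (K.gnomonic (t' i)) (K.gnomonic (t' j)) ≤ r :=
      (ht.dist_gnomonic_le hK hr i j).trans (mul_le_of_le_one_left (dist_nonneg.trans (hr 0 0))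
        (div_le_self zero_le_one (le_add_of_nonneg_right K.height_pos.le)))
    have hcos (j : Fin 3) := Cap.one_le_cos_half_mul_exp (hK (j + 1)) (hK (j + 2)) (hr _ _)
    have hcos' := Cap.one_le_cos_half_mul_exp (hK' (i + 1)) (hK' (i + 2)) (hr' _ _)
    have hsin := two_mul_sin_half_le_of_midline (exp_pos _).le (hcos (i + 1)) (hcos (i + 2))
      (sin_half_sphAngle_nonneg (t (i + 1)) (t (i + 2)))
      (isMedianGeometry_sphAngle.side_midline ht hp)
    have hexp : exp (1 / (4 * K.height ^ 2) * r ^ 2) =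
        exp (1 / (8 * K.height ^ 2) * r ^ 2) * exp (1 / (8 * K.height ^ 2) * r ^ 2) := by
      rw [← exp_add]
      ring_nf
    rw [hexp]
    exact two_mul_le_mul_of_sin_half_le (exp_pos _).le (sphAngle_nonneg _ _) (sphAngle_nonneg _ _)
      (Cap.sphAngle_lt_pi (hK' _) (hK' _)) hcos' hsin
  · rw [isMedianGeometry_sphAngle.side_eq_half ht hp, mul_div_cancel₀ _ two_ne_zero]
    exact le_mul_of_one_le_right (sphAngle_nonneg _ _) (one_le_exp (by positivity))

end IsPieceOf

/-- The bound on the distortion of the sides of all triangles nested in a triangle of perimeter `r`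
that lies in a cap of height `m`. -/
noncomputable def capStretch (m r : ℝ) : ℝ :=
  stretch (1 / (4 * m ^ 2)) (1 / (1 + m)) (2 / m ^ 2 * r)

theorem one_div_one_add_sq_lt_one {m : ℝ} (hm : 0 < m) : (1 / (1 + m)) ^ 2 < 1 :=
  pow_lt_one₀ (by positivity) ((div_lt_one (by positivity)).2 (lt_add_of_pos_right 1 hm))
    two_ne_zero

theorem one_lt_capStretch {m r : ℝ} (hm : 0 < m) (hr : r ≠ 0) : 1 < capStretch m r :=
  one_lt_stretch (by positivity) (one_div_one_add_sq_lt_one hm) (by positivity)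

namespace IsNested

variable {p : ℕ → Piece} {t : ℕ → Fin 3 → sphere (0 : V) 1}

theorem mem_cap (ht : IsNested sphAngle p t) (hK : ∀ i, t 0 i ∈ K.carrier) (n : ℕ) :
    ∀ i, t n i ∈ K.carrier := by
  induction n with
  | zero => exact hK
  | succ n ih => exact (ht n).mem_cap ih

theorem dist_gnomonic_le (ht : IsNested sphAngle p t) (hK : ∀ i, t 0 i ∈ K.carrier) (n : ℕ) :
    ∀ i j, dist (K.gnomonic (t n i)) (K.gnomonic (t n j)) ≤
      (1 / (1 + K.height)) ^ n * (2 / K.height ^ 2 * perimeter sphAngle (t 0)) := by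
  induction n with
  | zero =>
    intro i j
    rw [pow_zero, one_mul]
    refine (Cap.dist_gnomonic_le (hK i) (hK j)).trans ?_
    gcongr
    exact isMedianGeometry_sphAngle.dist_vertices_le_perimeter (t 0) i j
  | succ n ih =>
    rw [pow_succ', mul_assoc]
    exact (ht n).dist_gnomonic_le (ht.mem_cap hK n) ih

theorem monotone_two_pow_mul_side (ht : IsNested sphAngle p t) (hK : ∀ i, t 0 i ∈ K.carrier)
    (i : Fin 3) : Monotone fun n => 2 ^ n * side sphAngle (t n) i :=
  monotone_two_pow_mul fun n => (ht n).side_le_two_mul_side (ht.mem_cap hK n) i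

theorem side_le_two_pow_mul (ht : IsNested sphAngle p t) (hK : ∀ i, t 0 i ∈ K.carrier)
    (i : Fin 3) (n : ℕ) : side sphAngle (t 0) i ≤ 2 ^ n * side sphAngle (t n) i := by
  simpa using ht.monotone_two_pow_mul_side hK i n.zero_le

theorem side_lt_two_pow_mul (ht : IsNested sphAngle p t) (hK : ∀ i, t 0 i ∈ K.carrier)
    (hgram : gramDet sphAngle cos (t 0) ≠ 0) {i : Fin 3} {m n : ℕ}
    (hm : IsParallelStep (p m) i) (hmn : m < n) :
    side sphAngle (t 0) i < 2 ^ n * side sphAngle (t n) i := by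
  have hne := isMedianGeometry_sphAngle.side_ne_two_mul (ht m) hm
    (isMedianGeometry_sphAngle.gramDet_ne_zero_of_isNested ht hgram m)
  have hlt := lt_of_monotone_of_ne_succ (ht.monotone_two_pow_mul_side hK i) (m := m)
    (by simpa [pow_succ, mul_assoc] using hne) hmn
  simpa using hlt

theorem two_pow_mul_side_mul_stretch_le (ht : IsNested sphAngle p t)
    (hK : ∀ i, t 0 i ∈ K.carrier) (i : Fin 3) (n : ℕ) :
    2 ^ n * (side sphAngle (t n) i *
        capStretch K.height ((1 / (1 + K.height)) ^ n * perimeter sphAngle (t 0))) ≤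
      side sphAngle (t 0) i * capStretch K.height (perimeter sphAngle (t 0)) := by
  have hanti := antitone_two_pow_mul_stretch (a := fun n => side sphAngle (t n) i)
    (one_div_one_add_sq_lt_one K.height_pos) fun n =>
      (ht n).two_mul_side_le_side_mul_exp (ht.mem_cap hK n) (ht.dist_gnomonic_le hK n) i
  simpa [capStretch, mul_left_comm] using hanti n.zero_le

theorem two_pow_mul_side_le (ht : IsNested sphAngle p t) (hK : ∀ i, t 0 i ∈ K.carrier)
    (i : Fin 3) (n : ℕ) : 2 ^ n * side sphAngle (t n) i ≤
      side sphAngle (t 0) i * capStretch K.height (perimeter sphAngle (t 0)) := by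
  have hm := K.height_pos
  refine le_trans ?_ (ht.two_pow_mul_side_mul_stretch_le hK i n)
  gcongr
  exact le_mul_of_one_le_right (sphAngle_nonneg _ _)
    (one_le_stretch (by positivity) (one_div_one_add_sq_lt_one hm))

theorem two_pow_mul_side_lt (ht : IsNested sphAngle p t) (hK : ∀ i, t 0 i ∈ K.carrier)
    (h₀ : Nondegenerate sphAngle (t 0)) (i : Fin 3) (n : ℕ) : 2 ^ n * side sphAngle (t n) i <
      side sphAngle (t 0) i * capStretch K.height (perimeter sphAngle (t 0)) := by
  have hpos : 0 < side sphAngle (t n) i :=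
    pos_of_mul_pos_right ((h₀.side_pos i).trans_le (ht.side_le_two_pow_mul hK i n))
      (by positivity)
  have hm := K.height_pos
  have hr := h₀.perimeter_pos
  refine lt_of_lt_of_le ?_ (ht.two_pow_mul_side_mul_stretch_le hK i n)
  gcongr
  exact lt_mul_of_one_lt_right hpos (one_lt_capStretch hm (by positivity))

end IsNested

theorem InHemisphere.exists_cap {t : Fin 3 → sphere (0 : V) 1} (ht : InHemisphere t) :
    ∃ K : Cap V, ∀ i, t i ∈ K.carrier := by
  obtain ⟨u, hu⟩ := ht
  have hu0 : u ≠ 0 := by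
    rintro rfl
    simpa using hu 0
  obtain ⟨k, hk⟩ := Finite.exists_min fun i => inner ℝ (‖u‖⁻¹ • u) (t i : V)
  refine ⟨⟨‖u‖⁻¹ • u, inner ℝ (‖u‖⁻¹ • u) (t k : V), norm_smul_inv_norm hu0, ?_⟩, hk⟩
  rw [real_inner_smul_left]
  exact mul_pos (inv_pos.2 (norm_pos_iff.2 hu0)) (hu k)

theorem exists_cap_of_side_lt {t : Fin 3 → sphere (0 : V) 1}
    (ht : ∀ i, side sphAngle t i < π / 3) :
    ∃ K : Cap V, K.height = 1 / 2 ∧ ∀ i, t i ∈ K.carrier := by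
  refine ⟨⟨t 0, 1 / 2, norm_eq_of_mem_sphere _, by norm_num⟩, rfl, fun i => ?_⟩
  change 1 / 2 ≤ inner ℝ (t 0 : V) (t i : V)
  have hangle : sphAngle (t 0) (t i) ≤ π / 3 := by
    fin_cases i
    · rw [sphAngle]
      exact (angle_self (ne_zero_of_mem_unit_sphere (t 0))).trans_le (by positivity)
    · exact (ht 2).le
    · exact (isMedianGeometry_sphAngle.symm _ _).trans_le (ht 1).le
  rw [inner_eq_cos_sphAngle, ← cos_pi_div_three]
  exact cos_le_cos_of_nonneg_of_le_pi (sphAngle_nonneg _ _) (by linarith [pi_pos]) hangle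

/- All small triangles get the same height, because the factors `L` have to tend to `1` uniformly
in the triangle. -/
theorem InHemisphere.exists_cap_height {t : Fin 3 → sphere (0 : V) 1} (ht : InHemisphere t) :
    ∃ m, (∃ K : Cap V, K.height = m ∧ ∀ i, t i ∈ K.carrier) ∧
      ((∀ i, side sphAngle t i < π / 3) → m = 1 / 2) := by
  by_cases hsmall : ∀ i, side sphAngle t i < π / 3
  · exact ⟨1 / 2, exists_cap_of_side_lt hsmall, fun _ => rfl⟩
  · obtain ⟨K, hK⟩ := ht.exists_cap
    exact ⟨K.height, ⟨K, rfl, hK⟩, fun h => absurd h hsmall⟩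

end Nested

end Spherical

/-! ### Rescaled geometries -/

section General

open Real Metric

variable {X : Type*} {d : X → X → ℝ}

/-- The factors `l t i` bound from below the decay of the sides of all sequences of triangles
nested in `t`, as the theorem asserts for negative curvature. -/
def IsLowerSideFactor (d : X → X → ℝ) (l : (Fin 3 → X) → Fin 3 → ℝ) : Prop :=
  (∀ t₀ i, 0 < l t₀ i) ∧
  (∀ (p : ℕ → Piece) (t : ℕ → Fin 3 → X), IsNested d p t → ∀ i : Fin 3,
    (∀ n : ℕ, side d (t 0) i * l (t 0) i ≤ 2 ^ n * side d (t n) i ∧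
      2 ^ n * side d (t n) i ≤ side d (t 0) i) ∧
    (Nondegenerate d (t 0) → ∀ m : ℕ, IsParallelStep (p m) i →
      (∀ n : ℕ, side d (t 0) i * l (t 0) i < 2 ^ n * side d (t n) i) ∧
      (∀ n : ℕ, m < n → 2 ^ n * side d (t n) i < side d (t 0) i))) ∧
  (∀ t₀, Nondegenerate d t₀ → ∀ i, l t₀ i < 1) ∧
  (∀ ε : ℝ, 0 < ε → ∃ δ : ℝ, 0 < δ ∧ ∀ t₀, Nondegenerate d t₀ →
    (∀ j, side d t₀ j < δ) → ∀ i, 1 - ε < l t₀ i)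

/-- The factors `L t i` bound from above the sides of all sequences of triangles nested in a
triangle `t` that satisfies `P`, as the theorem asserts for positive curvature. -/
def IsUpperSideFactor (P : (Fin 3 → X) → Prop) (d : X → X → ℝ) (L : (Fin 3 → X) → Fin 3 → ℝ) :
    Prop :=
  (∀ t₀ i, 0 < L t₀ i) ∧
  (∀ (p : ℕ → Piece) (t : ℕ → Fin 3 → X), P (t 0) → IsNested d p t → ∀ i : Fin 3,
    (∀ n : ℕ, side d (t 0) i ≤ 2 ^ n * side d (t n) i ∧
      2 ^ n * side d (t n) i ≤ side d (t 0) i * L (t 0) i) ∧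
    (Nondegenerate d (t 0) → ∀ m : ℕ, IsParallelStep (p m) i →
      (∀ n : ℕ, m < n → side d (t 0) i < 2 ^ n * side d (t n) i) ∧
      (∀ n : ℕ, 2 ^ n * side d (t n) i < side d (t 0) i * L (t 0) i))) ∧
  (∀ t₀, P t₀ → Nondegenerate d t₀ → ∀ i, 1 < L t₀ i) ∧
  (∀ ε : ℝ, 0 < ε → ∃ δ : ℝ, 0 < δ ∧ ∀ t₀, P t₀ → Nondegenerate d t₀ →
    (∀ j, side d t₀ j < δ) → ∀ i, L t₀ i < 1 + ε)

theorem side_div (d : X → X → ℝ) (s : ℝ) (t : Fin 3 → X) (i : Fin 3) :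
    side (fun x y => d x y / s) t i = side d t i / s :=
  rfl

theorem IsMedianGeometry.exists_isLowerSideFactor (hd : IsMedianGeometry d cosh) {s : ℝ}
    (hs : 0 < s) : ∃ l, IsLowerSideFactor (fun x y => d x y / s) l := by
  simp only [IsLowerSideFactor, isNested_div hs.ne', nondegenerate_div hs, side_div,
    div_mul_eq_mul_div, mul_div_assoc', div_le_div_iff_of_pos_right hs,
    div_lt_div_iff_of_pos_right hs]
  refine ⟨fun t _ => (stretch (1 / 4) (1 / 2) (perimeter d t))⁻¹,
    fun t _ => inv_pos.2 (stretch_pos _ _ _),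
    fun p t ht i => ⟨fun n => ⟨hd.side_div_stretch_le ht i n, hd.two_pow_mul_side_le ht i n⟩,
      fun h₀ m hm => ⟨hd.side_div_stretch_lt ht h₀ i,
        fun n hmn => hd.two_pow_mul_side_lt ht h₀ hm hmn⟩⟩,
    fun t ht _ => inv_lt_one_of_one_lt₀
      (one_lt_stretch (by norm_num) (by norm_num) ht.perimeter_pos.ne'), fun ε hε => ?_⟩
  obtain ⟨δ, hδ, hlt⟩ := hd.exists_stretch_perimeter_lt (1 / 4) (1 / 2) 1 hε
  refine ⟨δ / s, div_pos hδ hs, fun t _ hsmall i => ?_⟩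
  have hS := hlt t fun j => (div_lt_div_iff_of_pos_right hs).1 (hsmall j)
  have hS1 : 1 ≤ stretch (1 / 4) (1 / 2) (perimeter d t) :=
    one_le_stretch (by norm_num) (by norm_num)
  rw [one_mul] at hS
  beta_reduce
  rw [← one_div, lt_div_iff₀ (stretch_pos _ _ _)]
  linarith [mul_nonneg hε.le (sub_nonneg.2 hS1)]

theorem exists_isUpperSideFactor_sphere (V : Type*) [NormedAddCommGroup V]
    [InnerProductSpace ℝ V] {s : ℝ} (hs : 0 < s) :
    ∃ L, IsUpperSideFactor InHemisphere (fun x y : sphere (0 : V) 1 => sphAngle x y / s) L := by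
  simp only [IsUpperSideFactor, isNested_div hs.ne', nondegenerate_div hs, side_div,
    div_mul_eq_mul_div, mul_div_assoc', div_le_div_iff_of_pos_right hs,
    div_lt_div_iff_of_pos_right hs]
  choose! m hcap hm using
    fun (t : Fin 3 → sphere (0 : V) 1) (ht : InHemisphere t) => ht.exists_cap_height
  refine ⟨fun t _ => capStretch (m t) (perimeter sphAngle t), fun t _ => stretch_pos _ _ _,
    fun p t h ht i => ?_, fun t h ht i => ?_, fun ε hε => ?_⟩
  · obtain ⟨K, hKm, hK⟩ := hcap _ h
    beta_reduce
    rw [← hKm]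
    exact ⟨fun n => ⟨ht.side_le_two_pow_mul hK i n, ht.two_pow_mul_side_le hK i n⟩,
      fun h₀ k hk =>
        ⟨fun n hkn => ht.side_lt_two_pow_mul hK (h₀.gramDet_cos_pos h).ne' hk hkn,
          ht.two_pow_mul_side_lt hK h₀ i⟩⟩
  · obtain ⟨K, hKm, -⟩ := hcap _ h
    beta_reduce
    rw [← hKm]
    exact one_lt_capStretch K.height_pos ht.perimeter_pos.ne'
  · obtain ⟨δ, hδ, hlt⟩ := (isMedianGeometry_sphAngle (V := V)).exists_stretch_perimeter_lt
      (1 / (4 * (1 / 2) ^ 2)) (1 / (1 + 1 / 2)) (2 / (1 / 2) ^ 2) hε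
    refine ⟨min δ (π / 3) / s, by positivity, fun t h _ hsmall i => ?_⟩
    simp only [div_lt_div_iff_of_pos_right hs, lt_min_iff] at hsmall
    beta_reduce
    rw [hm t h fun j => (hsmall j).2]
    exact hlt t fun j => (hsmall j).1

theorem theoremC_general (hd : IsMedianGeometry d cosh) (V : Type*) [NormedAddCommGroup V]
    [InnerProductSpace ℝ V] {s : ℝ} (hs : 0 < s) :
    (∃ l, IsLowerSideFactor (fun x y => d x y / s) l) ∧
    ∃ L, IsUpperSideFactor InHemisphere (fun x y : sphere (0 : V) 1 => sphAngle x y / s) L :=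
  ⟨hd.exists_isLowerSideFactor hs, exists_isUpperSideFactor_sphere V hs⟩

end General

end MedialSubdivision

open MedialSubdivision in
theorem theoremC :
    -- hyperbolic geometry
    (∀ κ : ℝ, κ < 0 → ∃ l : (Fin 3 → UpperHalfPlane) → Fin 3 → ℝ,
      (∀ t₀ i, 0 < l t₀ i) ∧
      (∀ (p : ℕ → Piece) (t : ℕ → Fin 3 → UpperHalfPlane), IsNested (hypDist κ) p t →
        ∀ i : Fin 3,
          (∀ n : ℕ,
            side (hypDist κ) (t 0) i * l (t 0) i ≤ 2 ^ n * side (hypDist κ) (t n) i ∧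
            2 ^ n * side (hypDist κ) (t n) i ≤ side (hypDist κ) (t 0) i) ∧
          (Nondegenerate (hypDist κ) (t 0) → ∀ m : ℕ, IsParallelStep (p m) i →
            (∀ n : ℕ,
              side (hypDist κ) (t 0) i * l (t 0) i < 2 ^ n * side (hypDist κ) (t n) i) ∧
            (∀ n : ℕ, m < n →
              2 ^ n * side (hypDist κ) (t n) i < side (hypDist κ) (t 0) i))) ∧
      (∀ t₀, Nondegenerate (hypDist κ) t₀ → ∀ i, l t₀ i < 1) ∧
      (∀ ε : ℝ, 0 < ε → ∃ δ : ℝ, 0 < δ ∧ ∀ t₀, Nondegenerate (hypDist κ) t₀ →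
        (∀ j, side (hypDist κ) t₀ j < δ) → ∀ i, 1 - ε < l t₀ i)) ∧
    -- spherical geometry
    (∀ κ : ℝ, 0 < κ → ∃ L : (Fin 3 → Sphere2) → Fin 3 → ℝ,
      (∀ t₀ i, 0 < L t₀ i) ∧
      (∀ (p : ℕ → Piece) (t : ℕ → Fin 3 → Sphere2), InOpenHemisphere (t 0) →
        IsNested (sphDist κ) p t →
        ∀ i : Fin 3,
          (∀ n : ℕ,
            side (sphDist κ) (t 0) i ≤ 2 ^ n * side (sphDist κ) (t n) i ∧
            2 ^ n * side (sphDist κ) (t n) i ≤ side (sphDist κ) (t 0) i * L (t 0) i) ∧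
          (Nondegenerate (sphDist κ) (t 0) → ∀ m : ℕ, IsParallelStep (p m) i →
            (∀ n : ℕ, m < n →
              side (sphDist κ) (t 0) i < 2 ^ n * side (sphDist κ) (t n) i) ∧
            (∀ n : ℕ,
              2 ^ n * side (sphDist κ) (t n) i < side (sphDist κ) (t 0) i * L (t 0) i))) ∧
      (∀ t₀, InOpenHemisphere t₀ → Nondegenerate (sphDist κ) t₀ → ∀ i, 1 < L t₀ i) ∧
      (∀ ε : ℝ, 0 < ε → ∃ δ : ℝ, 0 < δ ∧ ∀ t₀, InOpenHemisphere t₀ →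
        Nondegenerate (sphDist κ) t₀ →
        (∀ j, side (sphDist κ) t₀ j < δ) → ∀ i, L t₀ i < 1 + ε)) := by
  have general {s : ℝ} (hs : 0 < s) :=
    theoremC_general isQuadricModel_toHyperboloid.isMedianGeometry (EuclideanSpace ℝ (Fin 3)) hs
  exact ⟨fun _ hκ => (general (Real.sqrt_pos.2 (neg_pos.2 hκ))).1,
    fun _ hκ => (general (Real.sqrt_pos.2 hκ)).2⟩
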